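/- Let $(X,d)$ be a metric space. Let $\mathcal P(X)$ be the set of separably supported Borel probability measures on $X$, equipped with the (possibly infinite) Wasserstein-1 distance $d_W(\mu,\nu)=\inf_K\int_{X\times X} d(x,y)\,\mathrm dK(x,y)$, where $K$ ranges over the separably supported Borel probability measures on $X\times X$ with marginals $\mu$ and $\nu$; let $\mathcal P_1(X)$ be the set of those $\mu\in\mathcal P(X)$ with $d_W(\mu,\delta_x)<\infty$ for some Dirac measure $\delta_x$, $x\in X$. A contracting barycenter map on $X$ is a map $b:\mathcal P_1(X)\to X$ such that $b(\delta_x)=x$ for all $x\in X$ and $d(b(\mu),b(\nu))\le d_W(\mu,\nu)$ for all $\mu,\nu\in\mathcal P_1(X)$. Let $H^2$ be the closed unit hemisphere with its standard Riemannian (great-circle) distance, and let $S^1=\partial H^2$ be its boundary circle of length $2\pi$ with the induced distance, which is the arc-length distance. **Theorem 1.1.** Suppose that $X$ admits a contracting barycenter map, let $L\ge 0$, and let $\eta:S^1\to X$ be $L$-Lipschitz. Then there is an $L$-Lipschitz map $f:H^2\to X$ with $f|_{S^1}=\eta$. -/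

import Mathlib

open MeasureTheory
open scoped NNReal ENNReal

noncomputable section

/-- `SepProb Z` is the set `𝒫(Z)` of separably supported probability measures on the Borel
`σ`-algebra of `Z`: some separable set has full measure (its closure is then a closed separable
set of full measure). -/
structure SepProb (Z : Type*) [TopologicalSpace Z] where
  toMeasure : @Measure Z (borel Z)
  measure_univ : toMeasure Set.univ = 1
  exists_separable : ∃ S : Set Z, TopologicalSpace.IsSeparable S ∧ toMeasure Sᶜ = 0

/-- The Dirac measure `δ_x`. -/
def SepProb.dirac {Z : Type*} [MetricSpace Z] (x : Z) : SepProb Z where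
  toMeasure := @Measure.dirac Z (borel Z) x
  measure_univ := by
    let _ : MeasurableSpace Z := borel Z
    exact MeasureTheory.measure_univ
  exists_separable := by
    let _ : MeasurableSpace Z := borel Z
    have _ : BorelSpace Z := ⟨rfl⟩
    refine ⟨{x}, Set.Countable.isSeparable (Set.countable_singleton x), ?_⟩
    simp

/-- `K ∈ 𝒫(X × X)` is a coupling of `μ` and `ν` if its two marginals are `μ` and `ν`.
The measure `K` lives on the Borel `σ`-algebra of `X × X`. -/
def IsCoupling {X : Type*} [MetricSpace X] (K : SepProb (X × X)) (μ ν : SepProb X) : Prop :=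
  @Measure.map (X × X) X (borel (X × X)) (borel X) Prod.fst K.toMeasure = μ.toMeasure ∧
  @Measure.map (X × X) X (borel (X × X)) (borel X) Prod.snd K.toMeasure = ν.toMeasure

/-- The Wasserstein `1`-distance on `𝒫(X)`, with values in `[0, ∞]`: the infimum over all
couplings `K` of the integral of `d(x, y)` with respect to `K`. -/
def wassersteinDist {X : Type*} [MetricSpace X] (μ ν : SepProb X) : ℝ≥0∞ :=
  ⨅ (K : SepProb (X × X)) (_ : IsCoupling K μ ν),
    @lintegral (X × X) (borel (X × X)) K.toMeasure (fun p => edist p.1 p.2)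

/-- The Wasserstein `1`-space `𝒫₁(X)`: the measures at finite Wasserstein distance from the
Dirac measures. -/
def WassersteinSpace (X : Type*) [MetricSpace X] : Type _ :=
  {μ : SepProb X // ∃ x : X, wassersteinDist μ (SepProb.dirac x) < ∞}

theorem wassersteinDist_dirac_self {X : Type*} [MetricSpace X] (x : X) :
    wassersteinDist (SepProb.dirac x) (SepProb.dirac x) = 0 := by
  refine le_antisymm ?_ zero_le
  let _ : MeasurableSpace X := borel X
  have _ : BorelSpace X := ⟨rfl⟩
  have hc : IsCoupling (SepProb.dirac (x, x)) (SepProb.dirac x) (SepProb.dirac x) := by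
    constructor
    · exact @Measure.map_dirac' _ _ (borel (X × X)) (borel X) _
        (continuous_fst.borel_measurable) (x, x)
    · exact @Measure.map_dirac' _ _ (borel (X × X)) (borel X) _
        (continuous_snd.borel_measurable) (x, x)
  refine le_trans (iInf₂_le (SepProb.dirac (x, x)) hc) (le_of_eq ?_)
  have hm : @Measurable (X × X) ℝ≥0∞ (borel (X × X)) _ (fun p => edist p.1 p.2) := by
    have h : Continuous fun p : X × X => edist p.1 p.2 := continuous_edist
    have h2 := h.borel_measurable
    rwa [← BorelSpace.measurable_eq (α := ℝ≥0∞)] at h2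
  have := @lintegral_dirac' (X × X) (borel (X × X)) (x, x) _ hm
  exact this.trans (edist_self x)

/-- The Dirac map `δ : X → 𝒫₁(X)`. -/
def WassersteinSpace.dirac {X : Type*} [MetricSpace X] (x : X) : WassersteinSpace X :=
  ⟨SepProb.dirac x, x, by rw [wassersteinDist_dirac_self]; exact ENNReal.zero_lt_top⟩

/-- A contracting barycenter map on `X`: a retraction `b : 𝒫₁(X) → X` for the Dirac map `δ` that
is `1`-Lipschitz with respect to the Wasserstein `1`-distance. -/
def IsContractingBarycenterMap {X : Type*} [MetricSpace X] (b : WassersteinSpace X → X) : Prop :=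
  (∀ x : X, b (WassersteinSpace.dirac x) = x) ∧
  ∀ μ ν : WassersteinSpace X, edist (b μ) (b ν) ≤ wassersteinDist μ.1 ν.1

/-- The closed unit hemisphere `H²`, as the set of unit vectors of `ℝ³` with nonnegative last
coordinate. -/
@[ext]
structure Hemisphere where
  point : EuclideanSpace ℝ (Fin 3)
  norm_eq_one : ‖point‖ = 1
  nonneg : 0 ≤ point 2

theorem Hemisphere.point_ne_zero (p : Hemisphere) : p.point ≠ 0 := by
  intro h
  have := p.norm_eq_one
  simp [h] at this

/-- The Riemannian (great-circle) metric of the round hemisphere: the distance of two unit vectors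
is the angle between them. -/
instance Hemisphere.instMetricSpace : MetricSpace Hemisphere where
  dist p q := InnerProductGeometry.angle p.point q.point
  dist_self p := InnerProductGeometry.angle_self p.point_ne_zero
  dist_comm p q := InnerProductGeometry.angle_comm _ _
  dist_triangle p q r := InnerProductGeometry.angle_le_angle_add_angle _ _ _
  eq_of_dist_eq_zero := by
    intro p q h
    have h1 := (InnerProductGeometry.inner_eq_mul_norm_iff_angle_eq_zero
      p.point_ne_zero q.point_ne_zero).2 h
    rw [p.norm_eq_one, q.norm_eq_one, one_mul] at h1
    exact Hemisphere.ext ((inner_eq_one_iff_of_norm_eq_one p.norm_eq_one q.norm_eq_one).1 h1)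

/-- The boundary circle `S¹` of `H²`, with the metric of `H²` (its arc-length metric, total
length `2π`). -/
abbrev BoundaryCircle : Type := {p : Hemisphere // p.point 2 = 0}

end

open scoped ComplexConjugate

/-! It suffices to give each point `p` of the hemisphere a probability measure on the circle that is
the Dirac mass at `p` when `p` lies on the boundary, and that depends 1-Lipschitzly on `p` for the
Wasserstein distance. Push it forward by `η` and apply the barycenter map.

View the hemisphere as a hyperbolic plane in the upper half space `ℂ × (0, ∞)`. A point `p = (ξ, z)`
has a visual measure on `ℂ`, the law of `ξ + z y` for `y` distributed by `sphericalMeasure`. The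
measure on the circle is the law of the direction of `ξ + z y`.

Two interior points lie on a common great half circle, which after a rotation runs from `-1` to `1`.
The boost `y ↦ (y + k) / (k y + 1)` is a hyperbolic translation that preserves the hemisphere. For a
suitable `k` it carries the first point to the second, hence one visual measure to the other
(`exists_mobiusRotation_boost`). It never increases `|arg|` and keeps each open half plane bounded
by the real axis (`angle_boost`), so the transport cost is the difference of the means of `|arg|`.
By a Crofton argument that mean is the spherical distance from the point to `1`
(`lintegral_abs_arg`), and the triangle inequality bounds the cost by the distance of the two points
(`Hemisphere.exists_coupling`). -/

/-! ### Explicit improper integrals. -/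

theorem lintegral_Ioi_of_hasDerivAt_of_nonneg {g g' : ℝ → ℝ} {a l : ℝ}
    (hg : ∀ x, HasDerivAt g (g' x) x) (hg' : ∀ x, 0 ≤ g' x)
    (hl : Filter.Tendsto g Filter.atTop (nhds l)) :
    ∫⁻ x in Set.Ioi a, ENNReal.ofReal (g' x) = ENNReal.ofReal (l - g a) := by
  rw [← integral_Ioi_of_hasDerivAt_of_nonneg' (fun x _ => hg x) (fun x _ => hg' x) hl,
    ofReal_integral_eq_lintegral_ofReal
      (integrableOn_Ioi_deriv_of_nonneg' (fun x _ => hg x) (fun x _ => hg' x) hl)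
      (Filter.Eventually.of_forall hg')]

theorem lintegral_of_hasDerivAt_of_nonneg {g g' : ℝ → ℝ} {l m : ℝ}
    (hg : ∀ x, HasDerivAt g (g' x) x) (hg' : ∀ x, 0 ≤ g' x)
    (hl : Filter.Tendsto g Filter.atTop (nhds l)) (hm : Filter.Tendsto g Filter.atBot (nhds m)) :
    ∫⁻ x, ENNReal.ofReal (g' x) = ENNReal.ofReal (l - m) := by
  have hmono : Monotone g := monotone_of_hasDerivAt_nonneg hg hg'
  have hneg : ∫⁻ x in Set.Iic 0, ENNReal.ofReal (g' x) = ENNReal.ofReal (g 0 - m) := by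
    have hd : ∀ x, HasDerivAt (fun x => -g (-x)) (g' (-x)) x := fun x => by
      exact ((hg (-x)).comp x (hasDerivAt_neg x)).neg.congr_deriv (by simp)
    have h := lintegral_Ioi_of_hasDerivAt_of_nonneg (a := 0) hd (fun x => hg' _)
      (hm.comp Filter.tendsto_neg_atTop_atBot).neg
    rw [← setLIntegral_congr Iio_ae_eq_Iic, show g 0 - m = -m - -g (-0) by simp; ring, ← h,
      ← (Measure.measurePreserving_neg (volume : Measure ℝ)).setLIntegral_comp_preimage_emb
        (Homeomorph.neg ℝ).measurableEmbedding]
    simp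
  rw [← lintegral_add_compl _ (measurableSet_Iic (a := (0 : ℝ))), Set.compl_Iic, hneg,
    lintegral_Ioi_of_hasDerivAt_of_nonneg hg hg' hl, ← ENNReal.ofReal_add]
  · congr 1; ring
  · exact sub_nonneg.2 (hmono.le_of_tendsto hm 0)
  · exact sub_nonneg.2 (hmono.ge_of_tendsto hl 0)

theorem hasDerivAt_div_sqrt_one_add_sq (x : ℝ) :
    HasDerivAt (fun x : ℝ => x / √(1 + x ^ 2)) (√(1 + x ^ 2) ^ 3)⁻¹ x := by
  have h0 : 0 < 1 + x ^ 2 := by positivity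
  have hs : 0 < √(1 + x ^ 2) := Real.sqrt_pos.2 h0
  have h1 : HasDerivAt (fun x : ℝ => 1 + x ^ 2) (2 * x) x := by
    simpa using (hasDerivAt_pow 2 x).const_add 1
  refine ((hasDerivAt_id' x).div (h1.sqrt h0.ne') hs.ne').congr_deriv ?_
  field_simp
  rw [Real.sq_sqrt h0.le]
  ring

theorem tendsto_div_sqrt_one_add_sq :
    Filter.Tendsto (fun x : ℝ => x / √(1 + x ^ 2)) Filter.atTop (nhds 1) := by
  have h : Filter.Tendsto (fun x : ℝ => (√(1 + (x⁻¹) ^ 2))⁻¹) Filter.atTop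
      (nhds (√(1 + 0 ^ 2))⁻¹) := by
    refine Filter.Tendsto.inv₀ ?_ (by simp)
    exact (Filter.Tendsto.const_add 1 (tendsto_inv_atTop_zero.pow 2)).sqrt
  rw [show (√(1 + 0 ^ 2) : ℝ)⁻¹ = 1 by simp] at h
  refine h.congr' ?_
  filter_upwards [Filter.eventually_gt_atTop 0] with x hx
  rw [show 1 + x⁻¹ ^ 2 = (1 + x ^ 2) / x ^ 2 by field_simp; ring, Real.sqrt_div (by positivity),
    Real.sqrt_sq hx.le, inv_div]

/-- With `A ^ 2 = 1 + x ^ 2` this integrates the imaginary part out of the density of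
`sphericalMeasure`. -/
theorem lintegral_inv_sq_add_sq_sq {A : ℝ} (hA : 0 < A) :
    ∫⁻ y : ℝ, ENNReal.ofReal (Real.pi⁻¹ * ((A ^ 2 + y ^ 2) ^ 2)⁻¹) =
      ENNReal.ofReal (2⁻¹ * (A ^ 3)⁻¹) := by
  have hd : ∀ y : ℝ, HasDerivAt (fun y : ℝ => Real.pi⁻¹ *
      ((2 * A ^ 2)⁻¹ * (y / (A ^ 2 + y ^ 2)) + (2 * A ^ 3)⁻¹ * Real.arctan (y / A)))
      (Real.pi⁻¹ * ((A ^ 2 + y ^ 2) ^ 2)⁻¹) y := fun y => by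
    have h0 : A ^ 2 + y ^ 2 ≠ 0 := by positivity
    have h1 : HasDerivAt (fun y : ℝ => A ^ 2 + y ^ 2) (2 * y) y := by
      simpa using (hasDerivAt_pow 2 y).const_add (A ^ 2)
    have h2 := ((((hasDerivAt_id' y).div h1 h0).const_mul (2 * A ^ 2)⁻¹).add
      (((hasDerivAt_id' y).div_const A).arctan.const_mul (2 * A ^ 3)⁻¹)).const_mul Real.pi⁻¹
    refine h2.congr_deriv ?_
    have : 1 + (y / A) ^ 2 = (A ^ 2 + y ^ 2) / A ^ 2 := by field_simp
    rw [this]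
    field_simp
    ring
  have hinv : Filter.Tendsto (fun y : ℝ => y / (A ^ 2 + y ^ 2)) (Filter.cocompact ℝ) (nhds 0) := by
    refine squeeze_zero_norm (a := fun y : ℝ => ‖y‖⁻¹) (fun y => ?_)
      (tendsto_inv_atTop_zero.comp (tendsto_norm_cocompact_atTop ))
    rcases eq_or_ne y 0 with rfl | hy
    · simp
    · rw [norm_div, Real.norm_of_nonneg (by positivity : 0 ≤ A ^ 2 + y ^ 2),
        div_le_iff₀ (by positivity), inv_mul_eq_div, le_div_iff₀ (by positivity), Real.norm_eq_abs,
        abs_mul_abs_self]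
      nlinarith
  have htop : Filter.Tendsto (fun y : ℝ => Real.pi⁻¹ *
      ((2 * A ^ 2)⁻¹ * (y / (A ^ 2 + y ^ 2)) + (2 * A ^ 3)⁻¹ * Real.arctan (y / A))) Filter.atTop
      (nhds (Real.pi⁻¹ * ((2 * A ^ 2)⁻¹ * 0 + (2 * A ^ 3)⁻¹ * (Real.pi / 2)))) := by
    refine (((hinv.mono_left atTop_le_cocompact).const_mul _).add
      (Filter.Tendsto.const_mul _ ?_)).const_mul _
    exact (Real.tendsto_arctan_atTop.mono_right nhdsWithin_le_nhds).comp
      (Filter.tendsto_id.atTop_div_const hA)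
  have hbot : Filter.Tendsto (fun y : ℝ => Real.pi⁻¹ *
      ((2 * A ^ 2)⁻¹ * (y / (A ^ 2 + y ^ 2)) + (2 * A ^ 3)⁻¹ * Real.arctan (y / A))) Filter.atBot
      (nhds (Real.pi⁻¹ * ((2 * A ^ 2)⁻¹ * 0 + (2 * A ^ 3)⁻¹ * (-(Real.pi / 2))))) := by
    refine (((hinv.mono_left atBot_le_cocompact).const_mul _).add
      (Filter.Tendsto.const_mul _ ?_)).const_mul _
    exact (Real.tendsto_arctan_atBot.mono_right nhdsWithin_le_nhds).comp
      (Filter.tendsto_id.atBot_div_const hA)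
  rw [lintegral_of_hasDerivAt_of_nonneg hd (fun y => by positivity) htop hbot]
  congr 1
  field_simp
  ring

/-! ### The spherical measure on the plane. -/

/-- The image of the uniform probability measure of the round sphere under stereographic
projection to `ℂ`. -/
noncomputable def sphericalMeasure : Measure ℂ :=
  volume.withDensity fun y => ENNReal.ofReal (Real.pi⁻¹ * ((1 + ‖y‖ ^ 2) ^ 2)⁻¹)

theorem sphericalMeasure_preimage_re {s : Set ℝ} (hs : MeasurableSet s) :
    sphericalMeasure (Complex.re ⁻¹' s) =
      ∫⁻ x in s, ENNReal.ofReal (2⁻¹ * (√(1 + x ^ 2) ^ 3)⁻¹) := by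
  have hs' : MeasurableSet (Complex.re ⁻¹' s) := Complex.measurable_re hs
  rw [sphericalMeasure, withDensity_apply _ hs',
    ← Complex.volume_preserving_equiv_real_prod.symm.setLIntegral_comp_preimage_emb
      (MeasurableEquiv.measurableEmbedding _),
    show (Complex.measurableEquivRealProd.symm ⁻¹' (Complex.re ⁻¹' s)) = s ×ˢ Set.univ by
      ext; simp [Complex.measurableEquivRealProd],
    Measure.volume_eq_prod, setLIntegral_prod _ (by fun_prop)]
  refine lintegral_congr fun x => ?_
  rw [← lintegral_inv_sq_add_sq_sq (by positivity), Real.sq_sqrt (by positivity),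
    Measure.restrict_univ]
  refine lintegral_congr fun y => ?_
  rw [← Complex.normSq_eq_norm_sq]
  simp [Complex.measurableEquivRealProd, Complex.normSq_apply]
  ring_nf

theorem hasDerivAt_half_div_sqrt (x : ℝ) :
    HasDerivAt (fun x : ℝ => 2⁻¹ * (x / √(1 + x ^ 2))) (2⁻¹ * (√(1 + x ^ 2) ^ 3)⁻¹) x :=
  (hasDerivAt_div_sqrt_one_add_sq x).const_mul _

theorem sphericalMeasure_lt_re (a : ℝ) :
    sphericalMeasure {y | a < y.re} = ENNReal.ofReal ((1 - a / √(1 + a ^ 2)) / 2) := by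
  change sphericalMeasure (Complex.re ⁻¹' Set.Ioi a) = _
  rw [sphericalMeasure_preimage_re measurableSet_Ioi,
    lintegral_Ioi_of_hasDerivAt_of_nonneg hasDerivAt_half_div_sqrt (fun x => by positivity)
      (tendsto_div_sqrt_one_add_sq.const_mul _)]
  congr 1
  ring

instance : IsProbabilityMeasure sphericalMeasure where
  measure_univ := by
    have hbot : Filter.Tendsto (fun x : ℝ => x / √(1 + x ^ 2)) Filter.atBot (nhds (-1)) := by
      refine (tendsto_div_sqrt_one_add_sq.comp Filter.tendsto_neg_atBot_atTop).neg.congr fun x => ?_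
      simp [neg_div]
    rw [← Set.preimage_univ (f := Complex.re), sphericalMeasure_preimage_re MeasurableSet.univ,
      Measure.restrict_univ, lintegral_of_hasDerivAt_of_nonneg hasDerivAt_half_div_sqrt
      (fun x => by positivity) (tendsto_div_sqrt_one_add_sq.const_mul _) (hbot.const_mul _)]
    norm_num

/-- Makes the real axis negligible for the endpoints, and with it the origin, the branch cut of
`arg` and the poles of the boosts. -/
theorem sphericalMeasure_im_eq (c : ℝ) : sphericalMeasure {y | y.im = c} = 0 := by
  have hs : MeasurableSet {y : ℂ | y.im = c} := Complex.measurable_im (measurableSet_singleton c)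
  refine withDensity_absolutelyContinuous _ _ ?_
  rw [← Complex.volume_preserving_equiv_real_prod.symm.measure_preimage hs.nullMeasurableSet,
    show (Complex.measurableEquivRealProd.symm ⁻¹' {y : ℂ | y.im = c}) = Set.univ ×ˢ {c} by
      ext; simp [Complex.measurableEquivRealProd],
    Measure.volume_eq_prod, Measure.prod_prod]
  simp

/-! ### Invariance under rotations of the Riemann sphere. -/

/-- The Möbius transformation `y ↦ c (α y + β) / (-β̄ y + ᾱ)`. For `|c| = 1` and
`|α|² + |β|² = 1` it is a rotation of the Riemann sphere. -/
noncomputable def mobiusRotation (c α β : ℂ) (y : ℂ) : ℂ :=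
  c * ((α * y + β) / (-conj β * y + conj α))

theorem conj_mul_add_conj_mul_eq_one {α β : ℂ} (h : ‖α‖ ^ 2 + ‖β‖ ^ 2 = 1) :
    conj α * α + conj β * β = 1 := by
  rw [Complex.conj_mul', Complex.conj_mul']
  exact_mod_cast h

/-- The coefficient matrix is unitary. This identity makes the Jacobian of the Möbius map cancel
against the change of density. -/
theorem norm_sq_add_norm_sq_mobius {α β : ℂ} (h : ‖α‖ ^ 2 + ‖β‖ ^ 2 = 1) (y : ℂ) :
    ‖-conj β * y + conj α‖ ^ 2 + ‖α * y + β‖ ^ 2 = 1 + ‖y‖ ^ 2 := by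
  have h1 := conj_mul_add_conj_mul_eq_one h
  have : ((‖-conj β * y + conj α‖ ^ 2 + ‖α * y + β‖ ^ 2 : ℝ) : ℂ) = ((1 + ‖y‖ ^ 2 : ℝ) : ℂ) := by
    push_cast
    simp only [← Complex.conj_mul', map_add, map_mul, map_neg, Complex.conj_conj]
    linear_combination (1 + conj y * y) * h1
  exact_mod_cast this

theorem injOn_mobiusRotation {c α β : ℂ} (h : ‖α‖ ^ 2 + ‖β‖ ^ 2 = 1)
    (hc : c ≠ 0) :
    Set.InjOn (mobiusRotation c α β) {y | -conj β * y + conj α ≠ 0} := by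
  intro x hx y hy hxy
  have h1 := (div_eq_div_iff hx hy).1 (mul_left_cancel₀ hc hxy)
  linear_combination h1 + (y - x) * conj_mul_add_conj_mul_eq_one h

theorem hasDerivAt_mobiusRotation {c α β : ℂ} (h : ‖α‖ ^ 2 + ‖β‖ ^ 2 = 1)
    {y : ℂ} (hy : -conj β * y + conj α ≠ 0) :
    HasDerivAt (mobiusRotation c α β) (c * (1 / (-conj β * y + conj α) ^ 2)) y := by
  have hn : HasDerivAt (fun y => α * y + β) α y := by
    simpa using ((hasDerivAt_id' y).const_mul α).add_const β
  have hd : HasDerivAt (fun y => -conj β * y + conj α) (-conj β) y := by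
    simpa using ((hasDerivAt_id' y).const_mul (-conj β)).add_const (conj α)
  refine ((hn.div hd hy).const_mul c).congr_deriv ?_
  congr 2
  linear_combination conj_mul_add_conj_mul_eq_one h

theorem measurable_mobiusRotation (c α β : ℂ) : Measurable (mobiusRotation c α β) := by
  unfold mobiusRotation
  fun_prop

theorem abs_det_restrictScalars_mul (a : ℂ) :
    |((ContinuousLinearMap.toSpanSingleton ℂ a).restrictScalars ℝ : ℂ →L[ℝ] ℂ).det| = ‖a‖ ^ 2 := by
  have : (ContinuousLinearMap.toSpanSingleton ℂ a).toLinearMap.det = a := by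
    simp
  simp [ContinuousLinearMap.det, LinearMap.det_restrictScalars, Algebra.norm_complex_apply,
    Complex.normSq_eq_norm_sq]

theorem measurePreserving_mobiusRotation {c α β : ℂ} (h : ‖α‖ ^ 2 + ‖β‖ ^ 2 = 1)
    (hc : ‖c‖ = 1) :
    MeasurePreserving (mobiusRotation c α β) sphericalMeasure sphericalMeasure := by
  have hm := measurable_mobiusRotation c α β
  refine ⟨hm, ?_⟩
  have hc0 : c ≠ 0 := by rintro rfl; simp at hc
  set s : Set ℂ := {y | -conj β * y + conj α ≠ 0} with hs
  have hsm : MeasurableSet s := by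
    have : Measurable fun y : ℂ => -conj β * y + conj α := by fun_prop
    exact this (measurableSet_singleton 0).compl
  have hs0 : sphericalMeasure sᶜ = 0 := by
    have : (sᶜ).Subsingleton := by
      intro x hx y hy
      simp only [hs, Set.mem_compl_iff, Set.mem_ofPred_eq, not_not] at hx hy
      have h1 := conj_mul_add_conj_mul_eq_one h
      have hβ : conj β ≠ 0 := by
        intro h0
        rw [h0] at hx h1
        simp_all
      refine mul_left_cancel₀ hβ ?_
      linear_combination hy - hx
    exact withDensity_absolutelyContinuous _ _ (this.measure_zero volume)
  -- Both measures are finite of equal mass, so one inequality suffices and surjectivity of the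
  -- Möbius map is not needed.
  refine Measure.eq_of_le_of_measure_univ_eq (Measure.le_iff.2 fun t ht => ?_) ?_
  · rw [Measure.map_apply hm ht]
    have hst : MeasurableSet (mobiusRotation c α β ⁻¹' t ∩ s) := (hm ht).inter hsm
    calc sphericalMeasure (mobiusRotation c α β ⁻¹' t)
        ≤ sphericalMeasure (mobiusRotation c α β ⁻¹' t ∩ s) := by
          rw [measure_inter_conull hs0]
      _ = ∫⁻ y in mobiusRotation c α β '' (mobiusRotation c α β ⁻¹' t ∩ s),
            ENNReal.ofReal (Real.pi⁻¹ * ((1 + ‖y‖ ^ 2) ^ 2)⁻¹) := by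
          rw [lintegral_image_eq_lintegral_abs_det_fderiv_mul volume hst
            (fun y hy => ((hasDerivAt_mobiusRotation h hy.2).hasFDerivAt.restrictScalars
              ℝ).hasFDerivWithinAt) ((injOn_mobiusRotation h hc0).mono Set.inter_subset_right),
            sphericalMeasure, withDensity_apply _ hst]
          refine setLIntegral_congr_fun hst fun y hy => ?_
          have hy0 : 0 < ‖-conj β * y + conj α‖ := norm_pos_iff.2 hy.2
          have hn := norm_sq_add_norm_sq_mobius h y
          rw [abs_det_restrictScalars_mul, ← ENNReal.ofReal_mul (by positivity)]
          congr 1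
          have : 1 + ‖mobiusRotation c α β y‖ ^ 2 =
              (1 + ‖y‖ ^ 2) / ‖-conj β * y + conj α‖ ^ 2 := by
            rw [← hn, mobiusRotation, norm_mul, norm_div, hc, add_div,
              div_self (pow_pos hy0 2).ne', one_mul, div_pow]
          rw [this]
          simp only [norm_mul, norm_div, norm_pow, hc, norm_one]
          generalize ‖-conj β * y + conj α‖ = D at hy0
          field_simp
      _ ≤ sphericalMeasure t := by
          rw [sphericalMeasure, withDensity_apply _ ht]
          exact lintegral_mono_set (Set.image_subset_iff.2 Set.inter_subset_left)
  · rw [Measure.map_apply hm MeasurableSet.univ, Set.preimage_univ]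

theorem measurePreserving_unit_mul {a : ℂ} (ha : ‖a‖ = 1) :
    MeasurePreserving (fun y => a * y) sphericalMeasure sphericalMeasure := by
  convert measurePreserving_mobiusRotation (c := a) (α := 1) (β := 0) (by simp) ha using 1
  simp [mobiusRotation, funext_iff]

/-! ### Crofton formula: the mean of `|arg|` under a visual measure. -/

theorem re_mul_cos_add_im_mul_sin (y : ℂ) (s : ℝ) :
    y.re * Real.cos s + y.im * Real.sin s = ‖y‖ * Real.cos (y.arg - s) := by
  rw [Real.cos_sub]
  linear_combination -(Real.cos s) * Complex.norm_mul_cos_arg y -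
    (Real.sin s) * Complex.norm_mul_sin_arg y

/-- The half planes that contain `1` but not `y` have measure `|arg y|`. -/
theorem volume_separating_halfPlanes {y : ℂ} (hy : y ≠ 0) :
    volume {s ∈ Set.Ioo (-(Real.pi / 2)) (Real.pi / 2) |
      y.re * Real.cos s + y.im * Real.sin s < 0} = ENNReal.ofReal |y.arg| := by
  have hπ := Real.pi_pos
  have h0 : ∀ s, y.re * Real.cos s + y.im * Real.sin s < 0 ↔ Real.cos (y.arg - s) < 0 := fun s => by
    rw [re_mul_cos_add_im_mul_sin]
    exact ⟨fun h => by_contra fun h' => absurd h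
      (not_lt.2 (mul_nonneg (norm_nonneg y) (not_lt.1 h'))),
      fun h => mul_neg_of_pos_of_neg (norm_pos_iff.2 hy) h⟩
  have hl := Complex.neg_pi_lt_arg y
  have hu := Complex.arg_le_pi y
  simp only [h0]
  rcases le_total 0 y.arg with h | h
  · have : {s ∈ Set.Ioo (-(Real.pi / 2)) (Real.pi / 2) | Real.cos (y.arg - s) < 0} =
        Set.Ioo (-(Real.pi / 2)) (y.arg - Real.pi / 2) := by
      ext s
      simp only [Set.mem_ofPred_eq, Set.mem_Ioo]
      constructor
      · rintro ⟨⟨h1, h2⟩, h3⟩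
        refine ⟨h1, ?_⟩
        by_contra! h4
        exact absurd h3 (not_lt.2 (Real.cos_nonneg_of_mem_Icc ⟨by linarith, by linarith⟩))
      · rintro ⟨h1, h2⟩
        exact ⟨⟨h1, by linarith⟩, Real.cos_neg_of_pi_div_two_lt_of_lt (by linarith) (by linarith)⟩
    rw [this, Real.volume_Ioo, abs_of_nonneg h]
    congr 1
    ring
  · have : {s ∈ Set.Ioo (-(Real.pi / 2)) (Real.pi / 2) | Real.cos (y.arg - s) < 0} =
        Set.Ioo (y.arg + Real.pi / 2) (Real.pi / 2) := by
      ext s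
      simp only [Set.mem_ofPred_eq, Set.mem_Ioo]
      rw [← Real.cos_neg, neg_sub]
      constructor
      · rintro ⟨⟨h1, h2⟩, h3⟩
        refine ⟨?_, h2⟩
        by_contra! h4
        exact absurd h3 (not_lt.2 (Real.cos_nonneg_of_mem_Icc ⟨by linarith, by linarith⟩))
      · rintro ⟨h1, h2⟩
        exact ⟨⟨by linarith, h2⟩, Real.cos_neg_of_pi_div_two_lt_of_lt (by linarith) (by linarith)⟩
    rw [this, Real.volume_Ioo, abs_of_nonpos h]
    congr 1
    ring

theorem sphericalMeasure_halfPlane (ξ : ℂ) {z : ℝ} (hz : 0 < z) (s : ℝ) :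
    sphericalMeasure {y | (ξ + z * y).re * Real.cos s + (ξ + z * y).im * Real.sin s < 0} =
      ENNReal.ofReal ((1 - (ξ.re * Real.cos s + ξ.im * Real.sin s) /
        √(z ^ 2 + (ξ.re * Real.cos s + ξ.im * Real.sin s) ^ 2)) / 2) := by
  set w := ξ.re * Real.cos s + ξ.im * Real.sin s with hw
  -- Multiplication by this unit turns the half plane into `{y | w / z < y.re}`.
  set a : ℂ := -Complex.exp ((-s : ℝ) * Complex.I) with ha
  have han : ‖a‖ = 1 := by rw [ha, norm_neg, Complex.norm_exp_ofReal_mul_I]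
  have hre : a.re = -Real.cos s := by
    rw [ha, Complex.neg_re, Complex.exp_ofReal_mul_I_re, Real.cos_neg]
  have him : a.im = Real.sin s := by
    rw [ha, Complex.neg_im, Complex.exp_ofReal_mul_I_im, Real.sin_neg, neg_neg]
  have hset : {y : ℂ | (ξ + z * y).re * Real.cos s + (ξ + z * y).im * Real.sin s < 0} =
      (fun y => a * y) ⁻¹' {y | w / z < y.re} := by
    ext y
    simp only [Set.mem_ofPred_eq, Set.mem_preimage, Complex.mul_re, hre, him, div_lt_iff₀ hz,
      Complex.add_re, Complex.add_im, Complex.mul_im, Complex.ofReal_re, Complex.ofReal_im]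
    rw [← sub_neg, ← sub_neg (b := _ * z)]
    refine iff_of_eq (congrArg (· < 0) ?_)
    rw [hw]
    ring
  have hm : MeasurableSet {y : ℂ | w / z < y.re} :=
    measurableSet_lt measurable_const Complex.measurable_re
  rw [hset, (measurePreserving_unit_mul han).measure_preimage hm.nullMeasurableSet,
    sphericalMeasure_lt_re]
  congr 3
  rw [show 1 + (w / z) ^ 2 = (z ^ 2 + w ^ 2) / z ^ 2 by field_simp, Real.sqrt_div (by positivity),
    Real.sqrt_sq hz.le]
  field_simp

theorem lintegral_halfPlane {ξ : ℂ} {z : ℝ} (hz : 0 < z) (h : ‖ξ‖ ^ 2 + z ^ 2 = 1) :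
    ∫⁻ s in Set.Ioo (-(Real.pi / 2)) (Real.pi / 2),
      ENNReal.ofReal ((1 - (ξ.re * Real.cos s + ξ.im * Real.sin s) /
        √(z ^ 2 + (ξ.re * Real.cos s + ξ.im * Real.sin s) ^ 2)) / 2) =
      ENNReal.ofReal (Real.arccos ξ.re) := by
  have hn : ξ.re ^ 2 + ξ.im ^ 2 + z ^ 2 = 1 := by
    rw [← h, ← Complex.normSq_eq_norm_sq, Complex.normSq_apply]; ring
  have hv : ∀ s, z ^ 2 + (ξ.re * Real.cos s + ξ.im * Real.sin s) ^ 2 =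
      1 - (-ξ.re * Real.sin s + ξ.im * Real.cos s) ^ 2 := fun s => by
    linear_combination hn + (ξ.re ^ 2 + ξ.im ^ 2) * Real.sin_sq_add_cos_sq s
  have hpos : ∀ s, 0 < z ^ 2 + (ξ.re * Real.cos s + ξ.im * Real.sin s) ^ 2 := fun s => by positivity
  -- The argument `v` of `arcsin` has derivative `-w`, with `w = ξ.re cos s + ξ.im sin s`, and `z ^
  -- 2 + w ^ 2 = 1 - v ^ 2`; so `F` is an antiderivative of the integrand.
  set F : ℝ → ℝ := fun s => (s + Real.arcsin (-ξ.re * Real.sin s + ξ.im * Real.cos s)) / 2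
  set f : ℝ → ℝ := fun s => (1 - (ξ.re * Real.cos s + ξ.im * Real.sin s) /
        √(z ^ 2 + (ξ.re * Real.cos s + ξ.im * Real.sin s) ^ 2)) / 2 with hf
  have hF : ∀ s, HasDerivAt F (f s) s := fun s => by
    have h1 := ((Real.hasDerivAt_sin s).const_mul (-ξ.re)).add
      ((Real.hasDerivAt_cos s).const_mul ξ.im)
    have hlt : (-ξ.re * Real.sin s + ξ.im * Real.cos s) ^ 2 < 1 := by linarith [hv s, hpos s]
    rw [sq_lt_one_iff_abs_lt_one, abs_lt] at hlt
    have h2 := (Real.hasDerivAt_arcsin hlt.1.ne' hlt.2.ne).comp s h1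
    refine (((hasDerivAt_id' s).add h2).div_const 2).congr_deriv ?_
    simp only [hf, hv]
    ring
  have hcont : Continuous f := by
    have : ∀ s, √(z ^ 2 + (ξ.re * Real.cos s + ξ.im * Real.sin s) ^ 2) ≠ 0 :=
      fun s => (Real.sqrt_pos.2 (hpos s)).ne'
    simp only [hf]
    fun_prop (disch := assumption)
  have hnn : ∀ s, 0 ≤ f s := fun s => by
    have : (ξ.re * Real.cos s + ξ.im * Real.sin s) /
        √(z ^ 2 + (ξ.re * Real.cos s + ξ.im * Real.sin s) ^ 2) ≤ 1 := by
      refine (div_le_one (Real.sqrt_pos.2 (hpos s))).2 (Real.le_sqrt_of_sq_le ?_)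
      nlinarith
    simp only [hf]
    linarith
  have hle : -(Real.pi / 2) ≤ Real.pi / 2 := by linarith [Real.pi_pos]
  rw [← ofReal_integral_eq_lintegral_ofReal
      ((hcont.integrableOn_Icc).mono_set Set.Ioo_subset_Icc_self) (Filter.Eventually.of_forall hnn),
    ← integral_Ioc_eq_integral_Ioo, ← intervalIntegral.integral_of_le hle,
    intervalIntegral.integral_eq_sub_of_hasDerivAt (fun s _ => hF s)
      (hcont.intervalIntegrable _ _)]
  congr 1
  simp only [F, Real.sin_pi_div_two, Real.cos_pi_div_two, Real.sin_neg, Real.cos_neg]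
  simp only [mul_one, mul_zero, add_zero, mul_neg, neg_neg, Real.arcsin_neg, Real.arccos]
  ring

theorem ae_im_ne_zero (ξ : ℂ) {z : ℝ} (hz : 0 < z) :
    ∀ᵐ y ∂sphericalMeasure, (ξ + z * y).im ≠ 0 := by
  have h := sphericalMeasure_im_eq (-ξ.im / z)
  refine measure_mono_null (fun y hy => ?_) h
  simp only [Set.mem_compl_iff, Set.mem_ofPred_eq, not_not, Complex.add_im, Complex.mul_im,
    Complex.ofReal_re, Complex.ofReal_im] at hy ⊢
  rw [eq_div_iff hz.ne']
  linarith

/-- `|arg|` counts the half planes separating the endpoint from `1`. By Fubini one may instead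
integrate the visual measures of the half planes. The result is the spherical distance from `(ξ, z)`
to `1`. -/
theorem lintegral_abs_arg {ξ : ℂ} {z : ℝ} (hz : 0 < z) (h : ‖ξ‖ ^ 2 + z ^ 2 = 1) :
    ∫⁻ y, ENNReal.ofReal |(ξ + z * y).arg| ∂sphericalMeasure =
      ENNReal.ofReal (Real.arccos ξ.re) := by
  set I := Set.Ioo (-(Real.pi / 2)) (Real.pi / 2)
  set E : Set (ℂ × ℝ) :=
    {q | (ξ + z * q.1).re * Real.cos q.2 + (ξ + z * q.1).im * Real.sin q.2 < 0} with hE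
  have hEm : MeasurableSet E := measurableSet_lt (by fun_prop) measurable_const
  have h1 : ∫⁻ y, ENNReal.ofReal |(ξ + z * y).arg| ∂sphericalMeasure =
      ∫⁻ y, volume.restrict I (Prod.mk y ⁻¹' E) ∂sphericalMeasure := by
    refine lintegral_congr_ae ?_
    filter_upwards [ae_im_ne_zero ξ hz] with y hy
    have hy0 : ξ + z * y ≠ 0 := fun h0 => hy (by rw [h0]; rfl)
    rw [← volume_separating_halfPlanes hy0, Measure.restrict_apply (measurable_prodMk_left hEm),
      Set.inter_comm]
    rfl
  rw [h1, ← Measure.prod_apply hEm, Measure.prod_apply_symm hEm, ← lintegral_halfPlane hz h]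
  refine lintegral_congr fun s => ?_
  rw [← sphericalMeasure_halfPlane ξ hz s]
  rfl

/-! ### Boosts and their transport cost. -/

theorem angle_eq_arg_sub_arg {x y : ℂ} (hx : 0 < x.im) (hy : 0 < y.im)
    (h : 0 ≤ (x * conj y).im) : InnerProductGeometry.angle x y = x.arg - y.arg := by
  have hx0 : x ≠ 0 := fun h0 => by simp [h0] at hx
  have hy0 : y ≠ 0 := fun h0 => by simp [h0] at hy
  have hn : 0 < ‖x‖ * ‖y‖ := mul_pos (norm_pos_iff.2 hx0) (norm_pos_iff.2 hy0)
  have hxa : 0 < x.arg := lt_of_le_of_ne (Complex.arg_nonneg_iff.2 hx.le)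
    fun h0 => hx.ne' (Complex.arg_eq_zero_iff.1 h0.symm).2
  have hya : 0 < y.arg := lt_of_le_of_ne (Complex.arg_nonneg_iff.2 hy.le)
    fun h0 => hy.ne' (Complex.arg_eq_zero_iff.1 h0.symm).2
  have hxp := Complex.arg_le_pi x
  have hyp := Complex.arg_le_pi y
  have h1 := Complex.norm_mul_cos_arg x
  have h2 := Complex.norm_mul_sin_arg x
  have h3 := Complex.norm_mul_cos_arg y
  have h4 := Complex.norm_mul_sin_arg y
  have hsin : 0 ≤ Real.sin (x.arg - y.arg) := by
    have : (x * conj y).im = ‖x‖ * ‖y‖ * Real.sin (x.arg - y.arg) := by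
      rw [Complex.mul_im, Complex.conj_re, Complex.conj_im, Real.sin_sub]
      calc _ = (‖x‖ * Real.sin x.arg) * (‖y‖ * Real.cos y.arg) -
            (‖x‖ * Real.cos x.arg) * (‖y‖ * Real.sin y.arg) := by rw [h1, h2, h3, h4]; ring
        _ = _ := by ring
    rw [this] at h
    exact nonneg_of_mul_nonneg_right h hn
  have hle : 0 ≤ x.arg - y.arg := by
    by_contra! hlt
    exact absurd hsin (not_le.2 (Real.sin_neg_of_neg_of_neg_pi_lt hlt (by linarith)))
  refine Real.injOn_cos ⟨InnerProductGeometry.angle_nonneg _ _, InnerProductGeometry.angle_le_pi _ _⟩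
    ⟨hle, by linarith⟩ ?_
  rw [InnerProductGeometry.cos_angle, div_eq_iff hn.ne', Real.cos_sub, Complex.inner, Complex.mul_re,
    Complex.conj_re, Complex.conj_im]
  calc _ = y.re * x.re + y.im * x.im := by ring
    _ = (‖y‖ * Real.cos y.arg) * (‖x‖ * Real.cos x.arg) +
        (‖y‖ * Real.sin y.arg) * (‖x‖ * Real.sin x.arg) := by rw [h1, h2, h3, h4]
    _ = _ := by ring

theorem boost_denominator_ne_zero (k : ℝ) {y : ℂ} (hy : y.im ≠ 0) : (k * y + 1 : ℂ) ≠ 0 := by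
  intro h0
  have him := congrArg Complex.im h0
  have hre := congrArg Complex.re h0
  simp at him hre
  rcases him with rfl | him
  · simp at hre
  · exact hy him

theorem im_boost {k : ℝ} {y : ℂ} (hy : (k * y + 1 : ℂ) ≠ 0) :
    ((y + k) / (k * y + 1)).im = (1 - k ^ 2) * y.im / Complex.normSq (k * y + 1) := by
  have h0 : Complex.normSq (k * y + 1) ≠ 0 := fun h => hy (Complex.normSq_eq_zero.1 h)
  rw [Complex.div_im, ← sub_div]
  congr 1
  simp
  ring

/-- Its sign shows that, in the upper half plane, a boost with `0 ≤ k < 1` does not increase the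
argument. -/
theorem im_mul_conj_boost {k : ℝ} {y : ℂ} (hy : (k * y + 1 : ℂ) ≠ 0) :
    (y * conj ((y + k) / (k * y + 1))).im =
      k * y.im * (y.re ^ 2 + y.im ^ 2 + 1 + 2 * k * y.re) / Complex.normSq (k * y + 1) := by
  have h0 : Complex.normSq (k * y + 1) ≠ 0 := fun h => hy (Complex.normSq_eq_zero.1 h)
  have h1 : conj (k * y + 1 : ℂ) ≠ 0 := (map_ne_zero _).2 hy
  have : y * conj ((y + k) / (k * y + 1)) =
      (y * conj (y + k) * (k * y + 1)) / (Complex.normSq (k * y + 1) : ℝ) := by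
    rw [Complex.normSq_eq_conj_mul_self, map_div₀,
      mul_div_mul_right _ _ hy, mul_div_assoc]
  rw [this, Complex.div_ofReal_im]
  congr 1
  simp
  ring

/-- The boost `y ↦ (y + k) / (k y + 1)` moves every half circle from `-1` to `1` monotonically
towards `1`. -/
theorem angle_boost {k : ℝ} (hk0 : 0 ≤ k) (hk1 : k < 1) {y : ℂ} (hy : y.im ≠ 0) :
    ((y + k) / (k * y + 1)).im ≠ 0 ∧
      InnerProductGeometry.angle y ((y + k) / (k * y + 1)) =
      |y.arg| - |((y + k) / (k * y + 1)).arg| := by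
  have key : ∀ y : ℂ, 0 < y.im → 0 < ((y + k) / (k * y + 1)).im ∧
      InnerProductGeometry.angle y ((y + k) / (k * y + 1)) =
      |y.arg| - |((y + k) / (k * y + 1)).arg| := fun y hy => by
    have hd := boost_denominator_ne_zero k hy.ne'
    have hN : 0 < Complex.normSq (k * y + 1) := Complex.normSq_pos.2 hd
    have h1 : 0 < ((y + k) / (k * y + 1)).im := by
      rw [im_boost hd]
      have : 0 < 1 - k ^ 2 := by nlinarith
      positivity
    refine ⟨h1, ?_⟩
    rw [abs_of_nonneg (Complex.arg_nonneg_iff.2 hy.le),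
      abs_of_nonneg (Complex.arg_nonneg_iff.2 h1.le)]
    refine angle_eq_arg_sub_arg hy h1 ?_
    rw [im_mul_conj_boost hd]
    have : 0 ≤ y.re ^ 2 + y.im ^ 2 + 1 + 2 * k * y.re := by
      nlinarith [sq_nonneg (y.re + k), sq_nonneg y.im]
    positivity
  rcases hy.lt_or_gt with hneg | hpos
  -- Boosts with real `k` commute with conjugation, which preserves angles and `|arg|`.
  · have h := key (conj y) (by simpa using hneg)
    have hc : (conj y + k) / (k * conj y + 1) = conj ((y + k) / (k * y + 1)) := by simp
    rw [hc] at h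
    have habs : ∀ x : ℂ, |(conj x).arg| = |x.arg| := fun x => by
      rw [Complex.arg_conj]
      split_ifs with hx
      · rw [hx]
      · rw [abs_neg]
    rw [habs, habs] at h
    refine ⟨fun h0 => ?_, ?_⟩
    · have h1 := h.1
      rw [Complex.conj_im, h0] at h1
      simp at h1
    · rw [← h.2]
      exact (Complex.conjLIE.toLinearIsometry.angle_map _ _).symm
  · exact ⟨(key y hpos).1.ne', (key y hpos).2⟩

/-- On the unit hemisphere the extended boost sends real part `p` to `(2k + (1 + k²)p) / N` and
scales imaginary part and height by `(1 - k²) / N`, where `N = 1 + k² + 2kp`. The two equations ask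
that these be `q` and `μ`. -/
theorem exists_boost_parameter {p q μ : ℝ} (hp : p ^ 2 < 1) (hq : q ^ 2 < 1) (hpq : p ≤ q)
    (hμ : 0 < μ) (h : μ ^ 2 * (1 - p ^ 2) = 1 - q ^ 2) :
    ∃ k : ℝ, 0 ≤ k ∧ k < 1 ∧ 1 - k ^ 2 = μ * (1 + k ^ 2 + 2 * k * p) ∧
      2 * k + (1 + k ^ 2) * p = q * (1 + k ^ 2 + 2 * k * p) := by
  have ha : 0 < 1 - p ^ 2 := by linarith
  have hpq1 : 0 < 1 - p * q := by nlinarith [sq_nonneg (p - q)]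
  -- The equations give `q - p = 2k(1 - p²) / N` and `D = 2(1 - p²) / N`, whence `k = (q - p) / D`.
  set D := 1 - p * q + μ * (1 - p ^ 2) with hD
  have hD0 : 0 < D := by positivity
  have hsq : (q - p) ^ 2 = D ^ 2 - 2 * μ * (1 - p ^ 2) * D := by
    rw [hD]
    linear_combination (1 - p ^ 2) * h
  have hk2 : ((q - p) / D) ^ 2 = 1 - 2 * μ * (1 - p ^ 2) / D := by
    rw [div_pow, hsq]
    field_simp
  have hN : 1 + ((q - p) / D) ^ 2 + 2 * ((q - p) / D) * p = 2 * (1 - p ^ 2) / D := by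
    rw [hk2]
    field_simp
    rw [hD]
    ring
  refine ⟨(q - p) / D, div_nonneg (by linarith) hD0.le, ?_, ?_, ?_⟩
  · have : ((q - p) / D) ^ 2 < 1 := by
      rw [hk2]
      have : 0 < 2 * μ * (1 - p ^ 2) / D := by positivity
      linarith
    exact (abs_lt.1 ((sq_lt_one_iff_abs_lt_one _).1 this)).2
  · rw [hN, hk2]
    ring
  · rw [hN, hk2]
    field_simp
    rw [hD]
    ring

/-- Visual measures of points on a common half circle from `-1` to `1` are coupled by a boost. -/
theorem exists_mobiusRotation_boost {ξ ξ' : ℂ} {z z' μ : ℝ} (hz : 0 < z)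
    (h : ‖ξ‖ ^ 2 + z ^ 2 = 1) (h' : ‖ξ'‖ ^ 2 + z' ^ 2 = 1) (hμ : 0 < μ) (him : ξ'.im = μ * ξ.im)
    (hz' : z' = μ * z) (hre : ξ.re ≤ ξ'.re) :
    ∃ (k : ℝ) (α β : ℂ), 0 ≤ k ∧ k < 1 ∧ ‖α‖ ^ 2 + ‖β‖ ^ 2 = 1 ∧
      ∀ y : ℂ, (k * (ξ + z * y) + 1 : ℂ) ≠ 0 →
        ξ' + z' * mobiusRotation 1 α β y = (ξ + z * y + k) / (k * (ξ + z * y) + 1) := by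
  rw [← Complex.normSq_eq_norm_sq, Complex.normSq_apply] at h h'
  have hz'0 : 0 < z' := hz' ▸ mul_pos hμ hz
  obtain ⟨k, hk0, hk1, hk2, hk3⟩ := exists_boost_parameter (p := ξ.re) (q := ξ'.re)
    (by nlinarith) (by nlinarith) hre hμ (by
      rw [him, hz'] at h'
      linear_combination h' - μ ^ 2 * h)
  set N := 1 + k ^ 2 + 2 * k * ξ.re with hN
  have hN0 : 0 < N := by
    have : 0 < μ * N := by rw [← hk2]; nlinarith
    exact pos_of_mul_pos_right this hμ.le
  have hρ : 0 < √N := Real.sqrt_pos.2 hN0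
  have hρ2 : √N ^ 2 = N := Real.sq_sqrt hN0.le
  have hρc : ((√N : ℝ) : ℂ) ≠ 0 := by exact_mod_cast hρ.ne'
  -- The boost conjugated by the similarities `y ↦ ξ + z y` and `y ↦ ξ' + z' y` fixes `(0, 1)` in
  -- the upper half space, so it is a rotation; these are its normalized coefficients.
  refine ⟨k, (k * conj ξ + 1) / (√N : ℝ), (-(k * z) : ℝ) / (√N : ℝ), hk0, hk1, ?_, fun y hy => ?_⟩
  · rw [← Complex.normSq_eq_norm_sq, ← Complex.normSq_eq_norm_sq, Complex.normSq_div,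
      Complex.normSq_div, ← add_div, Complex.normSq_ofReal, Complex.normSq_ofReal, ← sq √N, hρ2,
      div_eq_one_iff_eq hN0.ne']
    simp only [Complex.normSq_apply, Complex.add_re, Complex.mul_re, Complex.add_im, Complex.mul_im,
      Complex.ofReal_re, Complex.ofReal_im, Complex.conj_re, Complex.conj_im, Complex.one_re,
      Complex.one_im]
    rw [hN]
    linear_combination k ^ 2 * h
  · have hden : -conj ((-(k * z) : ℝ) / (√N : ℝ) : ℂ) * y + conj ((k * conj ξ + 1) / (√N : ℝ)) =
        (k * (ξ + z * y) + 1) / (√N : ℝ) := by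
      simp only [map_div₀, map_add, map_mul, Complex.conj_ofReal, Complex.conj_conj, map_one]
      push_cast
      ring
    have hnum : (k * conj ξ + 1) / (√N : ℝ) * y + (-(k * z) : ℝ) / (√N : ℝ) =
        ((k * conj ξ + 1) * y - k * z) / (√N : ℝ) := by
      push_cast
      ring
    rw [mobiusRotation, one_mul, hden, hnum, div_div_div_cancel_right₀ hρc, eq_div_iff hy, add_mul,
      mul_assoc (z' : ℂ), div_mul_cancel₀ _ hy]
    have hre' : ξ'.re * N = 2 * k + (1 + k ^ 2) * ξ.re := hk3.symm
    -- `c1` and `c2` compare the coefficients of `y` and of `1` after clearing denominators.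
    have c1 : ξ' * (k * z) + z' * (k * conj ξ + 1) = z := by
      apply Complex.ext
      · simp
        rw [hz']
        refine mul_right_cancel₀ hN0.ne' ?_
        linear_combination k * z * hre' - z * (k * ξ.re + 1) * hk2 - z * hN
      · simp
        rw [hz', him]
        ring
    have c2 : ξ' * (k * ξ + 1) - z' * (k * z) = ξ + k := by
      apply Complex.ext
      · simp
        rw [hz', him]
        refine mul_right_cancel₀ hN0.ne' ?_
        linear_combination (k * ξ.re + 1) * hre' + k * (ξ.im ^ 2 + z ^ 2) * hk2 -
          k * (1 - k ^ 2) * h - (ξ.re + k) * hN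
      · simp
        rw [him]
        refine mul_right_cancel₀ hN0.ne' ?_
        linear_combination k * ξ.im * hre' - (k * ξ.re + 1) * ξ.im * hk2 - ξ.im * hN
    linear_combination y * c1 + c2

theorem exists_coupling_of_halfCircle {ξ ξ' : ℂ} {z z' μ : ℝ} (hz : 0 < z)
    (h : ‖ξ‖ ^ 2 + z ^ 2 = 1) (h' : ‖ξ'‖ ^ 2 + z' ^ 2 = 1) (hμ : 0 < μ) (him : ξ'.im = μ * ξ.im)
    (hz' : z' = μ * z) (hre : ξ.re ≤ ξ'.re) :
    ∃ Ψ : ℂ → ℂ, MeasurePreserving Ψ sphericalMeasure sphericalMeasure ∧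
      ∫⁻ y, ENNReal.ofReal (InnerProductGeometry.angle (ξ + z * y) (ξ' + z' * Ψ y))
        ∂sphericalMeasure ≤ ENNReal.ofReal (Real.arccos ξ.re - Real.arccos ξ'.re) := by
  obtain ⟨k, α, β, hk0, hk1, hαβ, hΨ⟩ := exists_mobiusRotation_boost hz h h' hμ him hz' hre
  have hmp := measurePreserving_mobiusRotation (c := 1) hαβ (by simp)
  have hz'0 : 0 < z' := hz' ▸ mul_pos hμ hz
  have hm : ∀ (ξ : ℂ) (z : ℝ), Measurable fun y : ℂ => ENNReal.ofReal |(ξ + z * y).arg| := by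
    intro ξ z
    have : Measurable fun y : ℂ => (ξ + z * y).arg := Complex.measurable_arg.comp (by fun_prop)
    exact (measurable_abs.comp this).ennreal_ofReal
  refine ⟨_, hmp, ?_⟩
  have hcost : ∀ᵐ y ∂sphericalMeasure,
      InnerProductGeometry.angle (ξ + z * y) (ξ' + z' * mobiusRotation 1 α β y) =
      |(ξ + z * y).arg| - |(ξ' + z' * mobiusRotation 1 α β y).arg| := by
    filter_upwards [ae_im_ne_zero ξ hz] with y hy
    rw [hΨ y (boost_denominator_ne_zero k hy)]
    exact (angle_boost hk0 hk1 hy).2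
  have hfin : ∫⁻ y, ENNReal.ofReal |(ξ' + z' * mobiusRotation 1 α β y).arg| ∂sphericalMeasure =
      ENNReal.ofReal (Real.arccos ξ'.re) := by
    rw [hmp.lintegral_comp (hm ξ' z'), lintegral_abs_arg hz'0 h']
  calc _ = ∫⁻ y, (ENNReal.ofReal |(ξ + z * y).arg| -
        ENNReal.ofReal |(ξ' + z' * mobiusRotation 1 α β y).arg|) ∂sphericalMeasure := by
        refine lintegral_congr_ae ?_
        filter_upwards [hcost] with y hy
        rw [hy, ENNReal.ofReal_sub _ (abs_nonneg _)]
    _ = ENNReal.ofReal (Real.arccos ξ.re) - ENNReal.ofReal (Real.arccos ξ'.re) := by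
        rw [lintegral_sub (g := fun y => ENNReal.ofReal |(ξ' + z' * mobiusRotation 1 α β y).arg|)
            ((hm ξ' z').comp hmp.measurable) (by rw [hfin]; exact ENNReal.ofReal_ne_top),
          lintegral_abs_arg hz h, hfin]
        filter_upwards [hcost] with y hy
        refine ENNReal.ofReal_le_ofReal ?_
        linarith [InnerProductGeometry.angle_nonneg (ξ + z * y) (ξ' + z' * mobiusRotation 1 α β y)]
    _ ≤ _ := by rw [ENNReal.ofReal_sub _ (Real.arccos_nonneg _)]

noncomputable instance Circle.instMeasurableSpace : MeasurableSpace Circle := borel Circle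

instance Circle.instBorelSpace : BorelSpace Circle := ⟨rfl⟩

/-! ### Visual measures on the hemisphere and their couplings. -/

namespace Hemisphere

/-- The orthogonal projection of a point of the hemisphere to the plane of the boundary circle. -/
noncomputable def horizontal (p : Hemisphere) : ℂ := ⟨p.point 0, p.point 1⟩

/-- The last coordinate of a point of the hemisphere. -/
noncomputable def height (p : Hemisphere) : ℝ := p.point 2

theorem norm_sq_horizontal_add_height_sq (p : Hemisphere) :
    ‖p.horizontal‖ ^ 2 + p.height ^ 2 = 1 := by
  have h := EuclideanSpace.norm_sq_eq p.point
  rw [p.norm_eq_one, Fin.sum_univ_three] at h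
  simp only [Real.norm_eq_abs, sq_abs] at h
  rw [← Complex.normSq_eq_norm_sq, Complex.normSq_apply]
  simp only [horizontal, height]
  linarith

theorem dist_eq_arccos (p q : Hemisphere) :
    dist p q = Real.arccos ((conj q.horizontal * p.horizontal).re + p.height * q.height) := by
  change InnerProductGeometry.angle p.point q.point = _
  rw [InnerProductGeometry.angle, p.norm_eq_one, q.norm_eq_one, mul_one, div_one, PiLp.inner_apply,
    Fin.sum_univ_three]
  congr 1
  simp [horizontal, height]
  ring

/-- The point of the boundary circle with given direction. -/
noncomputable def boundaryPoint (c : Circle) : BoundaryCircle :=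
  ⟨⟨!₂[(c : ℂ).re, (c : ℂ).im, 0], by
    rw [EuclideanSpace.norm_eq, Fin.sum_univ_three, Real.sqrt_eq_one]
    have h := Circle.normSq_coe c
    rw [Complex.normSq_apply] at h
    simp only [Real.norm_eq_abs, sq_abs]
    simpa [sq] using h, by simp⟩, by simp⟩

theorem horizontal_boundaryPoint (c : Circle) : (boundaryPoint c).1.horizontal = c := by
  apply Complex.ext <;> simp [horizontal, boundaryPoint]

theorem height_boundaryPoint (c : Circle) : (boundaryPoint c).1.height = 0 := by
  simp [height, boundaryPoint]

theorem dist_boundaryPoint (c c' : Circle) :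
    dist (boundaryPoint c) (boundaryPoint c') = InnerProductGeometry.angle (c : ℂ) c' := by
  rw [Subtype.dist_eq, dist_eq_arccos, horizontal_boundaryPoint, horizontal_boundaryPoint,
    height_boundaryPoint, InnerProductGeometry.angle, Circle.norm_coe, Circle.norm_coe,
    Complex.inner]
  simp [mul_comm]

theorem continuous_boundaryPoint : Continuous boundaryPoint := by
  refine (LipschitzWith.of_dist_le_mul (K := (Real.pi / 2).toNNReal) fun c c' => ?_).continuous
  have h : dist c c' = ‖(c : ℂ) - c'‖ := dist_eq_norm (c : ℂ) c'
  rw [dist_boundaryPoint, Real.coe_toNNReal _ (by positivity), h]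
  exact Complex.angle_le_mul_norm_sub (Circle.norm_coe c) (Circle.norm_coe c')

/-- The ideal endpoint in `ℂ` of the hyperbolic geodesic from `p` with direction `y`, where the
hemisphere is regarded as a hyperbolic plane in the upper half space `ℂ × (0, ∞)`. -/
noncomputable def endpoint (p : Hemisphere) (y : ℂ) : ℂ := p.horizontal + p.height * y

/-- The direction in the boundary circle of `p.endpoint y`. -/
noncomputable def endpointDirection (p : Hemisphere) (y : ℂ) : Circle :=
  Circle.exp (p.endpoint y).arg

theorem measurable_endpoint (p : Hemisphere) : Measurable p.endpoint := by
  unfold endpoint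
  fun_prop

theorem measurable_endpointDirection (p : Hemisphere) : Measurable p.endpointDirection :=
  Circle.exp.continuous.measurable.comp (Complex.measurable_arg.comp p.measurable_endpoint)

theorem horizontal_ne_zero {p : Hemisphere} (hp : p.height = 0) : p.horizontal ≠ 0 := by
  intro h
  have := p.norm_sq_horizontal_add_height_sq
  simp [h, hp] at this

theorem norm_horizontal_eq_one {p : Hemisphere} (hp : p.height = 0) : ‖p.horizontal‖ = 1 := by
  have := p.norm_sq_horizontal_add_height_sq
  rw [hp] at this
  nlinarith [norm_nonneg p.horizontal]

theorem height_nonneg (p : Hemisphere) : 0 ≤ p.height := p.nonneg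

theorem ae_endpoint_ne_zero (p : Hemisphere) : ∀ᵐ y ∂sphericalMeasure, p.endpoint y ≠ 0 := by
  rcases p.height_nonneg.eq_or_lt with h | h
  · refine Filter.Eventually.of_forall fun y => ?_
    simpa [endpoint, ← h] using horizontal_ne_zero h.symm
  · filter_upwards [ae_im_ne_zero p.horizontal h] with y hy h0
    exact hy (congrArg Complex.im h0)

theorem _root_.angle_circleExp_arg {x y : ℂ} (hx : x ≠ 0) (hy : y ≠ 0) :
    InnerProductGeometry.angle (Circle.exp x.arg : ℂ) (Circle.exp y.arg) =
      InnerProductGeometry.angle x y := by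
  have h : ∀ x : ℂ, x = ‖x‖ • (Circle.exp x.arg : ℂ) := fun x => by
    rw [Circle.coe_exp, Complex.real_smul, Complex.norm_mul_exp_arg_mul_I]
  conv_rhs => rw [h x, h y]
  rw [InnerProductGeometry.angle_smul_left_of_pos _ _ (norm_pos_iff.2 hx),
    InnerProductGeometry.angle_smul_right_of_pos _ _ (norm_pos_iff.2 hy)]

theorem boundaryPoint_arg_horizontal {p : Hemisphere} (hp : p.height = 0) :
    boundaryPoint (Circle.exp p.horizontal.arg) = ⟨p, hp⟩ := by
  have h : (Circle.exp p.horizontal.arg : ℂ) = p.horizontal := by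
    rw [Circle.coe_exp]
    simpa [norm_horizontal_eq_one hp] using Complex.norm_mul_exp_arg_mul_I p.horizontal
  refine Subtype.ext (Hemisphere.ext ?_)
  have h0 := congrArg Complex.re h
  have h1 := congrArg Complex.im h
  ext i
  fin_cases i
  · exact h0
  · exact h1
  · exact hp.symm

theorem _root_.Measurable.angle {α : Type*} [MeasurableSpace α] {f g : α → ℂ} (hf : Measurable f)
    (hg : Measurable g) : Measurable fun x => InnerProductGeometry.angle (f x) (g x) := by
  unfold InnerProductGeometry.angle
  exact Real.continuous_arccos.measurable.comp ((hf.inner hg).div (hf.norm.mul hg.norm))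

/-- Rotating `q` to `1` reduces this to `lintegral_abs_arg`. It settles the couplings in which one
point lies on the boundary, where no boost is available. -/
theorem lintegral_angle_of_height_eq_zero (p : Hemisphere) {q : Hemisphere} (hq : q.height = 0) :
    ∫⁻ y, ENNReal.ofReal (InnerProductGeometry.angle (p.endpoint y) q.horizontal)
      ∂sphericalMeasure = edist p q := by
  have hq0 := horizontal_ne_zero hq
  have hq1 : ‖conj q.horizontal‖ = 1 := by
    rw [RCLike.norm_conj, norm_horizontal_eq_one hq]
  have hqq : conj q.horizontal * q.horizontal = 1 := by
    rw [Complex.conj_mul', norm_horizontal_eq_one hq]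
    simp
  rw [edist_dist, dist_eq_arccos, hq, mul_zero, add_zero]
  have hangle : ∀ x : ℂ, x ≠ 0 → InnerProductGeometry.angle x q.horizontal =
      |(conj q.horizontal * x).arg| := fun x hx => by
    rw [← Complex.angle_mul_left ((map_ne_zero _).2 hq0 : conj q.horizontal ≠ 0), hqq,
      Complex.angle_one_right (mul_ne_zero ((map_ne_zero _).2 hq0) hx)]
  rcases p.height_nonneg.eq_or_lt with h | h
  · have hp1 := norm_horizontal_eq_one h.symm
    have : ∀ y, p.endpoint y = p.horizontal := fun y => by simp [endpoint, ← h]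
    simp only [this, lintegral_const, measure_univ, mul_one]
    rw [InnerProductGeometry.angle, Complex.inner, hp1, norm_horizontal_eq_one hq]
    congr 2
    simp [mul_comm]
  · have hn : ‖conj q.horizontal * p.horizontal‖ ^ 2 + p.height ^ 2 = 1 := by
      rw [norm_mul, hq1, one_mul, p.norm_sq_horizontal_add_height_sq]
    rw [← lintegral_abs_arg h hn,
      ← (measurePreserving_unit_mul hq1).lintegral_comp (f := fun y => ENNReal.ofReal
        |(conj q.horizontal * p.horizontal + p.height * y).arg|)]
    · refine lintegral_congr_ae ?_
      filter_upwards [p.ae_endpoint_ne_zero] with y hy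
      rw [hangle _ hy, endpoint]
      ring_nf
    · exact (measurable_abs.comp (Complex.measurable_arg.comp (by fun_prop))).ennreal_ofReal

theorem exists_boundary_direction (p q : Hemisphere) :
    ∃ c : Circle, (conj (c : ℂ) * (p.height * q.horizontal - q.height * p.horizontal)).im = 0 ∧
      (conj (c : ℂ) * p.horizontal).re ≤ (conj (c : ℂ) * q.horizontal).re := by
  -- This combination of `p` and `q` has height zero, so for `v ≠ 0` its direction is an end of the
  -- great half circle through them; for `v = 0` the first condition is vacuous.
  set v := p.height * q.horizontal - q.height * p.horizontal
  have hv : (conj (Circle.exp v.arg : ℂ) * v).im = 0 := by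
    have h : v = ‖v‖ * (Circle.exp v.arg : ℂ) := by
      rw [Circle.coe_exp, Complex.norm_mul_exp_arg_mul_I]
    conv_lhs => rw [h]
    rw [mul_left_comm]
    simp [Complex.conj_mul']
  rcases le_total (conj (Circle.exp v.arg : ℂ) * p.horizontal).re
    (conj (Circle.exp v.arg : ℂ) * q.horizontal).re with h | h
  · exact ⟨_, hv, h⟩
  -- The opposite end, so that `q` is the point nearer to `c`.
  · refine ⟨Circle.exp Real.pi * Circle.exp v.arg, ?_, ?_⟩
    · simp only [Circle.coe_mul, Circle.coe_exp Real.pi, Complex.exp_pi_mul_I, map_neg, neg_mul,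
        one_mul, Complex.neg_im, hv, neg_zero]
    · simpa only [Circle.coe_mul, Circle.coe_exp Real.pi, Complex.exp_pi_mul_I, map_neg, neg_mul,
        one_mul, Complex.neg_re, neg_le_neg_iff] using h

theorem dist_boundaryPoint_right (p : Hemisphere) (c : Circle) :
    dist p (boundaryPoint c).1 = Real.arccos (conj (c : ℂ) * p.horizontal).re := by
  rw [dist_eq_arccos, horizontal_boundaryPoint, height_boundaryPoint, mul_zero, add_zero]

theorem exists_coupling (p q : Hemisphere) :
    ∃ Ψ : ℂ → ℂ, MeasurePreserving Ψ sphericalMeasure sphericalMeasure ∧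
      ∫⁻ y, ENNReal.ofReal (InnerProductGeometry.angle (p.endpoint y) (q.endpoint (Ψ y)))
        ∂sphericalMeasure ≤ edist p q := by
  rcases q.height_nonneg.eq_or_lt with hq | hq
  · refine ⟨id, MeasurePreserving.id _, le_of_eq ?_⟩
    rw [← lintegral_angle_of_height_eq_zero p hq.symm]
    simp [endpoint, ← hq]
  rcases p.height_nonneg.eq_or_lt with hp | hp
  · refine ⟨id, MeasurePreserving.id _, le_of_eq ?_⟩
    rw [edist_comm, ← lintegral_angle_of_height_eq_zero q hp.symm]
    simp [endpoint, ← hp, InnerProductGeometry.angle_comm]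
  obtain ⟨c, hc, hle⟩ := exists_boundary_direction p q
  have hc1 : ‖conj (c : ℂ)‖ = 1 := by rw [RCLike.norm_conj, Circle.norm_coe]
  have hn : ∀ p : Hemisphere, ‖conj (c : ℂ) * p.horizontal‖ ^ 2 + p.height ^ 2 = 1 := fun p => by
    rw [norm_mul, hc1, one_mul, p.norm_sq_horizontal_add_height_sq]
  have him : (conj (c : ℂ) * q.horizontal).im =
      q.height / p.height * (conj (c : ℂ) * p.horizontal).im := by
    rw [mul_sub, mul_left_comm, mul_left_comm _ (q.height : ℂ), Complex.sub_im,
      Complex.im_ofReal_mul, Complex.im_ofReal_mul] at hc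
    field_simp
    linarith
  obtain ⟨Ψ, hΨ, hcost⟩ := exists_coupling_of_halfCircle hp (hn p) (hn q) (div_pos hq hp) him
    (div_mul_cancel₀ _ hp.ne').symm hle
  refine ⟨fun y => c * Ψ (conj (c : ℂ) * y), (measurePreserving_unit_mul (Circle.norm_coe c)).comp
    (hΨ.comp (measurePreserving_unit_mul hc1)), ?_⟩
  have hcc : conj (c : ℂ) * c = 1 := by
    rw [Complex.conj_mul', Circle.norm_coe]
    simp
  calc _ = ∫⁻ y, ENNReal.ofReal (InnerProductGeometry.angle
        (conj (c : ℂ) * p.horizontal + p.height * (conj (c : ℂ) * y))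
        (conj (c : ℂ) * q.horizontal + q.height * Ψ (conj (c : ℂ) * y))) ∂sphericalMeasure := by
        refine lintegral_congr fun y => ?_
        rw [← Complex.angle_mul_left ((map_ne_zero _).2 c.coe_ne_zero : conj (c : ℂ) ≠ 0)]
        congr 2
        · rw [endpoint]
          ring
        · rw [endpoint]
          linear_combination q.height * Ψ (conj (c : ℂ) * y) * hcc
    _ = ∫⁻ y, ENNReal.ofReal (InnerProductGeometry.angle
        (conj (c : ℂ) * p.horizontal + p.height * y)
        (conj (c : ℂ) * q.horizontal + q.height * Ψ y)) ∂sphericalMeasure := by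
        refine (measurePreserving_unit_mul hc1).lintegral_comp (f := fun y => ENNReal.ofReal
          (InnerProductGeometry.angle (conj (c : ℂ) * p.horizontal + p.height * y)
          (conj (c : ℂ) * q.horizontal + q.height * Ψ y))) ?_
        have := hΨ.measurable
        exact (Measurable.angle (by fun_prop) (by fun_prop)).ennreal_ofReal
    _ ≤ edist p q := by
        refine hcost.trans ?_
        rw [edist_dist, ← dist_boundaryPoint_right, ← dist_boundaryPoint_right]
        refine ENNReal.ofReal_le_ofReal ?_
        -- The cost is at most `d(p, c) - d(q, c)`.
        linarith [dist_triangle p q (boundaryPoint c).1]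

end Hemisphere

/-! ### Transfer to the Wasserstein space of `X`. -/

noncomputable section

theorem measurable_borel_comp {E Z : Type*} [TopologicalSpace E] [MeasurableSpace E]
    [OpensMeasurableSpace E] [TopologicalSpace Z] {g : E → Z} (hg : Continuous g) {φ : ℂ → E}
    (hφ : Measurable φ) : @Measurable ℂ Z _ (borel Z) (g ∘ φ) := by
  let _ : MeasurableSpace Z := borel Z
  have _ : BorelSpace Z := ⟨rfl⟩
  exact hg.measurable.comp hφ

/-- The law of `g ∘ φ` for the spherical measure, where `g` is continuous on a separable space. -/
def SepProb.ofMap {E Z : Type*} [TopologicalSpace E] [MeasurableSpace E]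
    [OpensMeasurableSpace E] [TopologicalSpace.SeparableSpace E] [TopologicalSpace Z] (g : E → Z)
    (hg : Continuous g) (φ : ℂ → E) (hφ : Measurable φ) : SepProb Z where
  toMeasure := @Measure.map ℂ Z _ (borel Z) (g ∘ φ) sphericalMeasure
  measure_univ := by
    let _ : MeasurableSpace Z := borel Z
    rw [Measure.map_apply (measurable_borel_comp hg hφ) MeasurableSet.univ, Set.preimage_univ,
      MeasureTheory.measure_univ]
  exists_separable := by
    let _ : MeasurableSpace Z := borel Z
    have _ : BorelSpace Z := ⟨rfl⟩
    refine ⟨closure (Set.range g), (TopologicalSpace.isSeparable_range hg).closure, ?_⟩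
    rw [Measure.map_apply (measurable_borel_comp hg hφ) isClosed_closure.measurableSet.compl]
    convert measure_empty (μ := sphericalMeasure)
    ext y
    simpa using subset_closure (Set.mem_range_self (f := g) (φ y))

theorem SepProb.ext {Z : Type*} [TopologicalSpace Z] {μ ν : SepProb Z}
    (h : μ.toMeasure = ν.toMeasure) : μ = ν := by
  cases μ
  cases ν
  cases h
  rfl

/-- Lets a measure preserving `Ψ` reparametrize one marginal, so that it defines a coupling. -/
theorem SepProb.ofMap_comp_measurePreserving {E Z : Type*} [TopologicalSpace E] [MeasurableSpace E]
    [OpensMeasurableSpace E] [TopologicalSpace.SeparableSpace E] [TopologicalSpace Z] {g : E → Z}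
    (hg : Continuous g) {φ : ℂ → E} (hφ : Measurable φ) {Ψ : ℂ → ℂ}
    (hΨ : MeasurePreserving Ψ sphericalMeasure sphericalMeasure) :
    SepProb.ofMap g hg (φ ∘ Ψ) (hφ.comp hΨ.measurable) = SepProb.ofMap g hg φ hφ := by
  let _ : MeasurableSpace Z := borel Z
  refine SepProb.ext ?_
  change Measure.map ((g ∘ φ) ∘ Ψ) sphericalMeasure = Measure.map (g ∘ φ) sphericalMeasure
  rw [← Measure.map_map (measurable_borel_comp hg hφ) hΨ.measurable, hΨ.map_eq]

theorem SepProb.ofMap_const {E X : Type*} [TopologicalSpace E] [MeasurableSpace E]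
    [OpensMeasurableSpace E] [TopologicalSpace.SeparableSpace E] [MetricSpace X] {g : E → X}
    (hg : Continuous g) (e : E) :
    SepProb.ofMap g hg (fun _ => e) measurable_const = SepProb.dirac (g e) := by
  let _ : MeasurableSpace X := borel X
  refine SepProb.ext ?_
  change Measure.map (fun _ => g e) sphericalMeasure = Measure.dirac (g e)
  rw [Measure.map_const, MeasureTheory.measure_univ, one_smul]

/-- The coupling is the joint law. It must live on the Borel `σ`-algebra of `X × X`, which may
exceed the product one; factoring through the second countable `Circle × Circle` gives measurability
and separable support. -/
theorem wassersteinDist_ofMap_le {X : Type*} [MetricSpace X] {γ : Circle → X} (hγ : Continuous γ)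
    {φ ψ : ℂ → Circle} (hφ : Measurable φ) (hψ : Measurable ψ) :
    wassersteinDist (SepProb.ofMap γ hγ φ hφ) (SepProb.ofMap γ hγ ψ hψ) ≤
      ∫⁻ y, edist (γ (φ y)) (γ (ψ y)) ∂sphericalMeasure := by
  let _ : MeasurableSpace X := borel X
  have hX : BorelSpace X := ⟨rfl⟩
  let M : MeasurableSpace (X × X) := borel (X × X)
  have hM : @BorelSpace (X × X) _ M := @BorelSpace.mk _ _ M rfl
  have hg : Continuous (Prod.map γ γ) := hγ.prodMap hγ
  have hm := measurable_borel_comp hg (hφ.prodMk hψ)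
  have hfst : @Measurable (X × X) X M _ Prod.fst :=
    @Continuous.measurable _ _ _ M _ _ _ _ _ continuous_fst
  have hsnd : @Measurable (X × X) X M _ Prod.snd :=
    @Continuous.measurable _ _ _ M _ _ _ _ _ continuous_snd
  have hed : @Measurable (X × X) ℝ≥0∞ M _ fun p => edist p.1 p.2 :=
    @Continuous.measurable _ _ _ M _ _ _ _ _ continuous_edist
  refine (iInf₂_le (SepProb.ofMap (Prod.map γ γ) hg (fun y => (φ y, ψ y)) (hφ.prodMk hψ))
    ⟨@Measure.map_map _ _ _ _ M _ _ _ _ hfst hm, @Measure.map_map _ _ _ _ M _ _ _ _ hsnd hm⟩).trans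
    (le_of_eq ?_)
  exact @lintegral_map _ _ _ M _ _ _ hed hm

theorem edist_comp_boundaryPoint_le {X : Type*} [MetricSpace X] {L : ℝ≥0} {η : BoundaryCircle → X}
    (hη : LipschitzWith L η) (c c' : Circle) :
    edist (η (Hemisphere.boundaryPoint c)) (η (Hemisphere.boundaryPoint c')) ≤
      L * ENNReal.ofReal (InnerProductGeometry.angle (c : ℂ) c') := by
  rw [← Hemisphere.dist_boundaryPoint, ← edist_dist]
  exact hη _ _

/-- The image under `η` of the visual measure of a point of the hemisphere. -/
def visualProb {X : Type*} [MetricSpace X] {L : ℝ≥0} {η : BoundaryCircle → X}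
    (hη : LipschitzWith L η) (p : Hemisphere) : SepProb X :=
  SepProb.ofMap (fun c => η (Hemisphere.boundaryPoint c))
    (hη.continuous.comp Hemisphere.continuous_boundaryPoint) p.endpointDirection
    p.measurable_endpointDirection

theorem wassersteinDist_visualProb_le {X : Type*} [MetricSpace X] {L : ℝ≥0}
    {η : BoundaryCircle → X} (hη : LipschitzWith L η) (p q : Hemisphere) :
    wassersteinDist (visualProb hη p) (visualProb hη q) ≤ L * edist p q := by
  obtain ⟨Ψ, hΨ, hcost⟩ := p.exists_coupling q
  have hc := hη.continuous.comp Hemisphere.continuous_boundaryPoint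
  have hcomp : visualProb hη q = SepProb.ofMap (fun c => η (Hemisphere.boundaryPoint c)) hc
      (q.endpointDirection ∘ Ψ) (q.measurable_endpointDirection.comp hΨ.measurable) :=
    (SepProb.ofMap_comp_measurePreserving hc q.measurable_endpointDirection hΨ).symm
  rw [hcomp]
  refine (wassersteinDist_ofMap_le hc _ _).trans ?_
  calc _ ≤ ∫⁻ y, L * ENNReal.ofReal (InnerProductGeometry.angle (p.endpoint y)
        (q.endpoint (Ψ y))) ∂sphericalMeasure := by
        refine lintegral_mono_ae ?_
        filter_upwards [p.ae_endpoint_ne_zero,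
          hΨ.quasiMeasurePreserving.ae q.ae_endpoint_ne_zero] with y hp hq
        rw [← angle_circleExp_arg hp hq]
        exact edist_comp_boundaryPoint_le hη _ _
    _ ≤ L * edist p q := by
        rw [lintegral_const_mul' _ _ ENNReal.coe_ne_top]
        gcongr

theorem visualProb_of_height_eq_zero {X : Type*} [MetricSpace X] {L : ℝ≥0}
    {η : BoundaryCircle → X} (hη : LipschitzWith L η) (p : BoundaryCircle) :
    visualProb hη p.1 = SepProb.dirac (η p) := by
  have hp : p.1.height = 0 := p.2
  have hc := hη.continuous.comp Hemisphere.continuous_boundaryPoint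
  have h : p.1.endpointDirection = fun _ => Circle.exp p.1.horizontal.arg := by
    funext y
    simp [Hemisphere.endpointDirection, Hemisphere.endpoint, hp]
  have hb : Hemisphere.boundaryPoint (Circle.exp p.1.horizontal.arg) = p :=
    Hemisphere.boundaryPoint_arg_horizontal hp
  simp only [visualProb, h]
  exact (SepProb.ofMap_const hc _).trans (by rw [Function.comp_apply, hb])

/-- The image under `η` of the visual measure, as a point of the Wasserstein space. -/
def visualPoint {X : Type*} [MetricSpace X] {L : ℝ≥0} {η : BoundaryCircle → X}
    (hη : LipschitzWith L η) (p : Hemisphere) : WassersteinSpace X :=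
  ⟨visualProb hη p, η (Hemisphere.boundaryPoint 1), by
    -- The Dirac mass is itself the visual law of a boundary point, so finiteness follows from the
    -- Lipschitz bound.
    rw [← visualProb_of_height_eq_zero hη]
    exact (wassersteinDist_visualProb_le hη _ _).trans_lt
      (ENNReal.mul_lt_top ENNReal.coe_lt_top (edist_lt_top _ _))⟩

end

theorem theorem1p1 {X : Type*} [MetricSpace X]
    (hX : ∃ b : WassersteinSpace X → X, IsContractingBarycenterMap b)
    (L : ℝ≥0) (η : BoundaryCircle → X) (hη : LipschitzWith L η) :
    ∃ f : Hemisphere → X, LipschitzWith L f ∧ ∀ p : BoundaryCircle, f p.1 = η p := by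
  obtain ⟨b, hb, hb'⟩ := hX
  refine ⟨fun p => b (visualPoint hη p), fun p q =>
    (hb' _ _).trans (wassersteinDist_visualProb_le hη p q), fun p => ?_⟩
  rw [← hb (η p)]
  exact congrArg b (Subtype.ext (visualProb_of_height_eq_zero hη p))
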